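/- All graphs are finite, simple and connected. For $h,s\in\mathbb{N}\cup\{\infty\}$ and $t\in\mathbb{N}$, a graph $G$ belongs to the class $[h,s,t]$ if there are a tree $T$ of maximum degree at most $h$ and a family $(P_v)_{v\in V(G)}$ of subtrees of $T$, each of maximum degree at most $s$, such that two distinct vertices $u,v$ of $G$ are adjacent if and only if $P_u$ and $P_v$ have at least $t$ vertices in common ($\infty$ means no restriction). A graph is VPT if it belongs to $[\infty,2,1]$, that is, if it is the vertex intersection graph of a family of paths in a tree. A clique of $G$ is an inclusion-maximal set of pairwise adjacent vertices, and $\mathcal{C}(G)$ is the set of cliques of $G$. For $C\in\mathcal{C}(G)$, the branch graph $B(G/C)$ (which need not be connected and may be empty) has as vertices the vertices of $V(G)\setminus C$ that are adjacent to some vertex of $C$; two such vertices $v,w$ are adjacent in $B(G/C)$ if and only if (1) $vw\notin E(G)$, (2) some vertex of $C$ is adjacent in $G$ to both $v$ and $w$, and (3) there are $v',w'\in C$ such that $v'$ is adjacent to $v$ and not to $w$, and $w'$ is adjacent to $w$ and not to $v$. The chromatic number is denoted by $\chi$. **Theorem.** Let $G$ be a VPT graph and $h\ge 4$ an integer. Then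 $$G\in[h,2,1]\setminus[h-1,2,1]\quad\Longleftrightarrow\quad \max_{C\in\mathcal{C}(G)}\chi\bigl(B(G/C)\bigr)=h .$$ The reverse implication ($\Leftarrow$) is also true for $h=3$. -/

import Mathlib

namespace SubtreeGraph

/-- `P` assigns to every vertex of `G` (the vertex set of) a subtree of the tree `T`, and this is an
`(h, s, t)`-representation of `G`: `T` has maximum degree at most `h`, every subtree has maximum
degree at most `s`, and two distinct vertices of `G` are adjacent iff their subtrees have at least
`t` vertices in common. The value `⊤` for `h` or `s` means no restriction. A subtree of a tree
is determined by its vertex set, because it is the subgraph induced on it. -/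
structure IsRepresentation {V W : Type*} (G : SimpleGraph V) (h s : ℕ∞) (t : ℕ)
    (T : SimpleGraph W) (P : V → Set W) : Prop where
  isTree : T.IsTree
  degree_le : ∀ x : W, (T.neighborSet x).encard ≤ h
  subtree_isTree : ∀ v : V, (T.induce (P v)).IsTree
  subtree_degree_le : ∀ (v : V) (x : P v), ((T.induce (P v)).neighborSet x).encard ≤ s
  adj_iff : ∀ u v : V, u ≠ v → (G.Adj u v ↔ (t : ℕ∞) ≤ (P u ∩ P v).encard)

/-- `G` belongs to the class `[h, s, t]`: it has an `(h, s, t)`-representation on some finite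
tree. -/
def MemClass {V : Type*} (h s : ℕ∞) (t : ℕ) (G : SimpleGraph V) : Prop :=
  ∃ (W : Type) (_ : Finite W) (T : SimpleGraph W) (P : V → Set W), IsRepresentation G h s t T P

/-- `G` is a VPT graph: a vertex intersection graph of paths in a tree, i.e. `G ∈ [∞, 2, 1]`. -/
def IsVPT {V : Type*} (G : SimpleGraph V) : Prop :=
  MemClass ⊤ 2 1 G

/-- The cliques of `G`, i.e. the inclusion-maximal complete sets of vertices. -/
def cliques {V : Type*} (G : SimpleGraph V) : Set (Set V) :=
  {C | Maximal G.IsClique C}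

/-- The branch graph `B(G/C)`. Its vertices are the vertices of `G` outside `C` that are adjacent to
some vertex of `C`. -/
def branchGraph {V : Type*} (G : SimpleGraph V) (C : Set V) :
    SimpleGraph {v : V // v ∉ C ∧ ∃ c ∈ C, G.Adj c v} where
  Adj v w :=
    ¬ G.Adj v w ∧
    (∃ c ∈ C, G.Adj c v ∧ G.Adj c w) ∧
    (∃ v' ∈ C, G.Adj v' v ∧ ¬ G.Adj v' w) ∧
    (∃ w' ∈ C, G.Adj w' w ∧ ¬ G.Adj w' v)
  symm := ⟨fun _ _ ⟨h, ⟨c, hc, h1, h2⟩, h3, h4⟩ =>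
    ⟨fun e => h e.symm, ⟨c, hc, h2, h1⟩, h4, h3⟩⟩
  loopless := ⟨fun _ ⟨_, _, ⟨_, _, h1, h2⟩, _⟩ => h2 h1⟩

/-- The maximum of the chromatic numbers `χ(B(G/C))` over all cliques `C` of `G` equals `m`. -/
def MaxBranchChromaticEq {V : Type*} (G : SimpleGraph V) (m : ℕ) : Prop :=
  IsGreatest {n : ℕ∞ | ∃ C ∈ cliques G, (branchGraph G C).chromaticNumber = n} (m : ℕ∞)

end SubtreeGraph

namespace SubtreeGraph

/-! ### Separation in a tree, gates of subtrees, Helly property -/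

open SimpleGraph

variable {V W : Type*} {T : SimpleGraph W}

/-! Everything reduces to one equivalence: for `n ≥ 3`, a VPT graph lies in `[n,2,1]` iff all its
branch graphs are `n`-colorable.

Necessity (`colorable_branchGraph`): by `helly` the paths of a clique `C` share a vertex `q`. Color
a vertex of `B(G/C)` by the neighbor of `q` through which its path is reached. If adjacent vertices
had the same color, some path of `C` would meet both of their paths on one side of `q`, so every
path of `C` reaching the farther one would meet the nearer one, against condition (3).

Sufficiency: contract until the paths through each `q` form a maximal clique. A coloring of its
branch graph yields one of the neighbors of `q` in which neighbors joined by a path through `q`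
differ. If `deg q > n`, two neighbors `a`, `b` share a color; hang them on a new vertex adjacent to
`q`. No path runs `a`-`q`-`b`, so paths stay paths; `deg q` drops, and the new vertex has degree 3.
-/

theorem exists_isPath_in {S : Set W} (hS : (T.induce S).Connected) {a b : W} (ha : a ∈ S)
    (hb : b ∈ S) : ∃ p : T.Walk a b, p.IsPath ∧ ∀ x ∈ p.support, x ∈ S := by
  classical
  obtain ⟨p⟩ := hS.preconnected ⟨a, ha⟩ ⟨b, hb⟩
  let q : T.Walk a b := p.map (Embedding.induce S).toHom
  refine ⟨q.bypass, q.bypass_isPath, fun x hx => ?_⟩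
  have := q.support_bypass_subset_support hx
  obtain ⟨y, -, rfl⟩ := List.mem_map.1 ((Walk.support_map _ p) ▸ this)
  exact y.2

/-- Every walk from `r` to `b` passes through `a`. -/
def Separates (T : SimpleGraph W) (r a b : W) : Prop :=
  ∀ p : T.Walk r b, a ∈ p.support

theorem Separates.refl (T : SimpleGraph W) (r a : W) : Separates T r a a :=
  fun p => p.end_mem_support

theorem Separates.trans {r a b c : W} (hab : Separates T r a b) (hbc : Separates T r b c) :
    Separates T r a c := by
  classical
  exact fun p => p.support_takeUntil_subset_support (hbc p) (hab (p.takeUntil b (hbc p)))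

theorem Separates.of_isPath (hT : T.IsAcyclic) {r a b : W} {p : T.Walk r b} (hp : p.IsPath)
    (ha : a ∈ p.support) : Separates T r a b := by
  classical
  intro q
  have h : (⟨p, hp⟩ : T.Path r b) = ⟨q.bypass, q.bypass_isPath⟩ :=
    (hT.subsingleton_path r b).elim _ _
  have h' : p = q.bypass := congrArg Subtype.val h
  exact q.support_bypass_subset_support (h' ▸ ha)

theorem Separates.antisymm (hT : T.Connected) {r a b : W} (hab : Separates T r a b)
    (hba : Separates T r b a) : a = b := by
  classical
  by_contra hne
  obtain ⟨p, hp⟩ := hT.exists_isPath r a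
  exact Walk.endpoint_notMem_support_takeUntil hp (hba p) (fun e => hne e) (hab _)

/-- Otherwise splice walks avoiding `a` or `b` into a path from `r` to `c`: that path must visit
`b`, then `a`, then `b` again. -/
theorem Separates.total (hT : T.Connected) {r a b c : W} (hac : Separates T r a c)
    (hbc : Separates T r b c) : Separates T r a b ∨ Separates T r b a := by
  classical
  by_contra! h
  obtain ⟨h₁, h₂⟩ := h
  simp only [Separates, not_forall] at h₁ h₂
  obtain ⟨p₁, hp₁⟩ := h₁
  obtain ⟨p₂, hp₂⟩ := h₂
  obtain ⟨p, hp⟩ := hT.exists_isPath r c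
  have hne : b ≠ a := by
    rintro rfl
    exact hp₁ p₁.end_mem_support
  have hq := hp.dropUntil (hbc p)
  set q := p.dropUntil b (hbc p)
  have haq : a ∈ q.support := by
    have := hac (p₁.append q)
    rw [Walk.mem_support_append_iff] at this
    exact this.resolve_left hp₁
  have hbq : b ∈ (q.dropUntil a haq).support := by
    have := hbc (p₂.append (q.dropUntil a haq))
    rw [Walk.mem_support_append_iff] at this
    exact this.resolve_left hp₂
  have hnd := hq.support_nodup
  rw [← q.take_spec haq, Walk.support_append, List.nodup_append] at hnd
  rw [Walk.mem_support_iff] at hbq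
  exact hnd.2.2 b (Walk.start_mem_support _) b (hbq.resolve_left hne) rfl

theorem Separates.eq_of_adj {r a b : W} (h : Separates T r a b) (hrb : T.Adj r b) (hne : a ≠ r) :
    a = b := by
  have := h hrb.toWalk
  simp only [Adj.toWalk, Walk.support_cons, Walk.support_nil, List.mem_cons,
    List.not_mem_nil, or_false] at this
  exact this.resolve_left hne

theorem Separates.of_adj_adj (hT : T.IsAcyclic) {a x b : W} (hax : T.Adj a x) (hxb : T.Adj x b)
    (hne : a ≠ b) : Separates T a x b := by
  refine Separates.of_isPath hT (p := .cons hax (.cons hxb .nil)) ?_ (by simp)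
  simp [hax.ne, hxb.ne, hne]

theorem Separates.mem {S : Set W} (hS : (T.induce S).Connected) {a x b : W}
    (h : Separates T a x b) (ha : a ∈ S) (hb : b ∈ S) : x ∈ S := by
  obtain ⟨p, -, hp⟩ := exists_isPath_in hS ha hb
  exact hp _ (h p)

theorem Separates.mem_of_between (hT : T.Connected) {S : Set W} (hS : (T.induce S).Connected)
    {r a b c : W} (hab : Separates T r a b) (hbc : Separates T r b c) (ha : a ∈ S) (hc : c ∈ S) :
    b ∈ S := by
  obtain ⟨p, -, hp⟩ := exists_isPath_in hS ha hc
  by_cases h : Separates T r b a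
  · rwa [← hab.antisymm hT h]
  · simp only [Separates, not_forall] at h
    obtain ⟨q, hq⟩ := h
    have := hbc (q.append p)
    rw [Walk.mem_support_append_iff] at this
    exact hp _ (this.resolve_left hq)

theorem separates_of_adj_of_notMem (hT : T.IsAcyclic) {S : Set W} (hS : (T.induce S).Connected)
    {q y z : W} (hqy : T.Adj q y) (hq : q ∉ S) (hy : y ∈ S) (hz : z ∈ S) : Separates T q y z := by
  obtain ⟨p, hp, hpS⟩ := exists_isPath_in hS hy hz
  refine Separates.of_isPath hT (p := .cons hqy p) ?_ (by simp)
  rw [Walk.cons_isPath_iff]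
  exact ⟨hp, fun h => hq (hpS _ h)⟩

theorem exists_walk_meeting_once {S : Set W} {r s : W} (p : T.Walk r s) (hs : s ∈ S) :
    ∃ m ∈ S, ∃ q : T.Walk r m, ∀ x ∈ q.support, x ∈ S → x = m := by
  induction p with
  | nil => exact ⟨_, hs, .nil, by simp⟩
  | @cons r u s h p ih =>
    by_cases hr : r ∈ S
    · exact ⟨r, hr, .nil, by simp⟩
    · obtain ⟨m, hm, q, hq⟩ := ih hs
      refine ⟨m, hm, .cons h q, fun x hx hxS => ?_⟩
      rw [Walk.support_cons, List.mem_cons] at hx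
      rcases hx with rfl | hx
      · exact absurd hxS hr
      · exact hq x hx hxS

/-- The gate `m` is the first vertex of `S` met from `r`; a path inside `S` continues the path to
`m` without repetition. -/
theorem exists_gate (hT : T.IsTree) {S : Set W} (hS : (T.induce S).Connected) (r : W) :
    ∃ m ∈ S, ∀ z ∈ S, Separates T r m z := by
  classical
  obtain ⟨s, hs⟩ := hS.nonempty
  obtain ⟨p⟩ := hT.connected.preconnected r s
  obtain ⟨m, hm, q, hq⟩ := exists_walk_meeting_once p hs
  refine ⟨m, hm, fun z hz => ?_⟩
  obtain ⟨t, ht, htS⟩ := exists_isPath_in hS hm hz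
  refine Separates.of_isPath hT.isAcyclic (p := q.bypass.append t) ?_ (by simp)
  rw [Walk.isPath_def, Walk.support_append, List.nodup_append]
  refine ⟨q.bypass_isPath.support_nodup, ht.support_nodup.tail, ?_⟩
  rintro x hx y hy rfl
  have hxm := hq x (q.support_bypass_subset_support hx) (htS x (List.mem_of_mem_tail hy))
  subst hxm
  have := ht.support_nodup
  rw [← Walk.cons_tail_support, List.nodup_cons] at this
  exact this.1 hy

/-- Pairwise intersecting subtrees of a finite tree have a common vertex. -/
theorem helly {ι : Type*} [Finite ι] [Finite W] (hT : T.IsTree) (P : ι → Set W)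
    (hP : ∀ i, (T.induce (P i)).Connected) (h : ∀ i j, (P i ∩ P j).Nonempty) :
    ∃ q, ∀ i, q ∈ P i := by
  obtain ⟨r⟩ := hT.connected.nonempty
  cases isEmpty_or_nonempty ι
  · exact ⟨r, fun i => isEmptyElim i⟩
  choose m hm hmP using fun i => exists_gate hT (hP i) r
  -- Take the deepest gate, depth being the number of ancestors with respect to the root `r`; it
  -- lies on every subtree.
  obtain ⟨v, hv⟩ := Finite.exists_max fun i => {b | Separates T r b (m i)}.ncard
  refine ⟨m v, fun u => ?_⟩
  obtain ⟨z, hzu, hzv⟩ := h u v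
  have huv : Separates T r (m u) (m v) := by
    rcases (hmP u z hzu).total hT.connected (hmP v z hzv) with h | h
    · exact h
    · have hsub : {b | Separates T r b (m v)} ⊆ {b | Separates T r b (m u)} :=
        fun b hb => Separates.trans hb h
      have := Set.eq_of_subset_of_ncard_le hsub (hv u)
      exact this.symm.subset (Separates.refl T r (m u))
  exact huv.mem_of_between hT.connected (hP u) (hmP v z hzv) (hm u) hzu

theorem ncard_le_two_cases {s : Set W} (hs : s.Finite) (h : s.ncard ≤ 2) {a b c : W} (ha : a ∈ s)
    (hb : b ∈ s) (hc : c ∈ s) : a = b ∨ a = c ∨ b = c := by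
  by_contra! hne
  have := (Set.two_lt_ncard_iff hs).2 ⟨a, b, c, ha, hb, hc, hne.1, hne.2.1, hne.2.2⟩
  omega

/-- As `c` uses up one of the at most two neighbors of `u` in `S`, both paths must continue alike
until one of them ends. -/
theorem mem_support_or_mem_support [Finite W] {S : Set W}
    (hdeg : ∀ x ∈ S, (T.neighborSet x ∩ S).ncard ≤ 2) {u a : W} (p : T.Walk u a) :
    ∀ {b c : W} (p' : T.Walk u b), T.Adj c u → c ∈ S → p.IsPath → p'.IsPath → c ∉ p.support →
      c ∉ p'.support → (∀ x ∈ p.support, x ∈ S) → (∀ x ∈ p'.support, x ∈ S) →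
      a ∈ p'.support ∨ b ∈ p.support := by
  induction p with
  | nil => exact fun p' _ _ _ _ _ _ _ _ => Or.inl p'.start_mem_support
  | @cons u w a h p ih =>
    intro b c p' hcu hc hp hp' hcp hcp' hpS hpS'
    cases p' with
    | nil => exact Or.inr (Walk.start_mem_support _)
    | @cons _ w' _ h' p' =>
      simp only [Walk.support_cons, List.mem_cons, not_or, Walk.cons_isPath_iff,
        forall_eq_or_imp] at hp hp' hcp hcp' hpS hpS' ⊢
      have hw : w = w' := by
        rcases ncard_le_two_cases (Set.toFinite _) (hdeg u hpS.1) ⟨hcu.symm, hc⟩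
          ⟨h, hpS.2 _ p.start_mem_support⟩ ⟨h', hpS'.2 _ p'.start_mem_support⟩ with e | e | e
        · exact absurd (e ▸ p.start_mem_support) hcp.2
        · exact absurd (e ▸ p'.start_mem_support) hcp'.2
        · exact e
      subst hw
      rcases ih p' h hpS.1 hp.1 hp'.1 hp.2 hp'.2 hpS.2 hpS'.2 with h | h
      · exact Or.inl (Or.inr h)
      · exact Or.inr (Or.inr h)

/-- A path through `q` has a single branch beyond `x`, so its vertices there are linearly ordered
from `q`. -/
theorem separates_or_separates_of_mem [Finite W] (hT : T.IsTree) {S : Set W}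
    (hS : (T.induce S).Connected) (hdeg : ∀ x ∈ S, (T.neighborSet x ∩ S).ncard ≤ 2) {q x a b : W}
    (hqx : T.Adj q x) (hq : q ∈ S) (ha : a ∈ S) (hb : b ∈ S) (hxa : Separates T q x a)
    (hxb : Separates T q x b) : Separates T q a b ∨ Separates T q b a := by
  have hx : x ∈ S := hxa.mem hS hq ha
  have key : ∀ {a}, a ∈ S → Separates T q x a → ∃ p : T.Walk x a, p.IsPath ∧ q ∉ p.support ∧
      ∀ y ∈ p.support, y ∈ S := by
    intro a ha hxa
    obtain ⟨p, hp, hpS⟩ := exists_isPath_in hS hq ha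
    cases p with
    | nil =>
      have := hxa .nil
      simp only [Walk.support_nil, List.mem_singleton] at this
      exact absurd this.symm hqx.ne
    | @cons _ y _ h p =>
      have hy : Separates T q y a := Separates.of_isPath hT.isAcyclic hp (by simp)
      have hyx : y = x := by
        rcases hy.total hT.connected hxa with h' | h'
        · exact h'.eq_of_adj hqx h.ne'
        · exact (h'.eq_of_adj h hqx.ne').symm
      subst hyx
      simp only [Walk.cons_isPath_iff, Walk.support_cons, List.mem_cons,
        forall_eq_or_imp] at hp hpS
      exact ⟨p, hp.1, hp.2, hpS.2⟩
  obtain ⟨p, hp, hqp, hpS⟩ := key ha hxa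
  obtain ⟨p', hp', hqp', hpS'⟩ := key hb hxb
  rcases mem_support_or_mem_support hdeg p p' hqx hq hp hp' hqp hqp' hpS hpS' with h | h
  · refine Or.inl (Separates.of_isPath hT.isAcyclic (p := .cons hqx p') ?_ (by simp [h]))
    exact (Walk.cons_isPath_iff ..).2 ⟨hp', hqp'⟩
  · refine Or.inr (Separates.of_isPath hT.isAcyclic (p := .cons hqx p) ?_ (by simp [h]))
    exact (Walk.cons_isPath_iff ..).2 ⟨hp, hqp⟩

/-! ### Path representations and the coloring of branch graphs -/

/-- `P` represents `G` as the vertex intersection graph of paths of the tree `T`. -/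
structure IsPathRepresentation (G : SimpleGraph V) (T : SimpleGraph W) (P : V → Set W) :
    Prop where
  isTree : T.IsTree
  connected : ∀ v, (T.induce (P v)).Connected
  ncard_le : ∀ v, ∀ x ∈ P v, (T.neighborSet x ∩ P v).ncard ≤ 2
  adj_iff : ∀ u v, u ≠ v → (G.Adj u v ↔ (P u ∩ P v).Nonempty)

theorem encard_neighborSet_induce (S : Set W) (x : S) :
    ((T.induce S).neighborSet x).encard = (T.neighborSet x ∩ S).encard := by
  rw [← Subtype.val_injective.encard_image]
  congr 1
  ext y
  simp only [Set.mem_image, mem_neighborSet, comap_adj, Function.Embedding.subtype_apply,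
    Subtype.exists, Set.mem_inter_iff]
  constructor
  · rintro ⟨y, hy, h, rfl⟩
    exact ⟨h, hy⟩
  · rintro ⟨h, hy⟩
    exact ⟨y, hy, h, rfl⟩

theorem encard_le_natCast_iff [Finite W] (s : Set W) (n : ℕ) : s.encard ≤ n ↔ s.ncard ≤ n := by
  rw [← (Set.toFinite s).cast_ncard_eq, Nat.cast_le]

theorem isRepresentation_iff [Finite W] {G : SimpleGraph V} {P : V → Set W} {h : ℕ∞} :
    IsRepresentation G h 2 1 T P ↔
      IsPathRepresentation G T P ∧ ∀ x, (T.neighborSet x).encard ≤ h := by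
  have h2 : ∀ s : Set W, s.encard ≤ 2 ↔ s.ncard ≤ 2 := fun s => encard_le_natCast_iff s 2
  constructor
  · intro R
    refine ⟨⟨R.isTree, fun v => (R.subtree_isTree v).connected, fun v x hx => ?_, fun u v huv => ?_⟩,
      R.degree_le⟩
    · rw [← h2, ← encard_neighborSet_induce (P v) ⟨x, hx⟩]
      exact R.subtree_degree_le v ⟨x, hx⟩
    · rw [R.adj_iff u v huv, Nat.cast_one, Set.one_le_encard_iff_nonempty]
  · rintro ⟨R, hd⟩
    refine ⟨R.isTree, hd, fun v => ⟨R.connected v, R.isTree.isAcyclic.induce _⟩, fun v x => ?_,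
      fun u v huv => ?_⟩
    · rw [encard_neighborSet_induce, h2]
      exact R.ncard_le v x x.2
    · rw [R.adj_iff u v huv, Nat.cast_one, Set.one_le_encard_iff_nonempty]

theorem IsPathRepresentation.inter_nonempty {G : SimpleGraph V} {P : V → Set W}
    (R : IsPathRepresentation G T P) {C : Set V} (hC : G.IsClique C) {u v : V} (hu : u ∈ C)
    (hv : v ∈ C) : (P u ∩ P v).Nonempty := by
  by_cases huv : u = v
  · subst huv
    rw [Set.inter_self]
    obtain ⟨x⟩ := (R.connected u).nonempty
    exact ⟨x, x.2⟩
  · exact (R.adj_iff u v huv).1 (hC hu hv huv)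

theorem IsPathRepresentation.isClique_setOf_mem {G : SimpleGraph V} {P : V → Set W}
    (R : IsPathRepresentation G T P) (q : W) : G.IsClique {v | q ∈ P v} :=
  fun u hu v hv huv => (R.adj_iff u v huv).2 ⟨q, hu, hv⟩

theorem IsPathRepresentation.exists_forall_mem [Finite V] [Finite W] {G : SimpleGraph V}
    {P : V → Set W} (R : IsPathRepresentation G T P) {C : Set V} (hC : G.IsClique C) :
    ∃ q, ∀ v ∈ C, q ∈ P v := by
  obtain ⟨q, hq⟩ := helly R.isTree (fun v : C => P v) (fun v => R.connected v)
    (fun u v => R.inter_nonempty hC u.2 v.2)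
  exact ⟨q, fun v hv => hq ⟨v, hv⟩⟩

theorem exists_adj_separates (hT : T.IsTree) {q m : W} (hqm : m ≠ q) :
    ∃ x, T.Adj q x ∧ Separates T q x m := by
  obtain ⟨p, hp⟩ := hT.connected.exists_isPath q m
  cases p with
  | nil => exact absurd rfl hqm
  | @cons _ x _ h p =>
    exact ⟨x, h, Separates.of_isPath hT.isAcyclic hp (by simp)⟩

theorem IsPathRepresentation.colorable_branchGraph [Finite V] [Finite W] {G : SimpleGraph V}
    {P : V → Set W} (R : IsPathRepresentation G T P) {h : ℕ}
    (hd : ∀ x, (T.neighborSet x).ncard ≤ h) {C : Set V} (hC : C ∈ cliques G) :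
    (branchGraph G C).Colorable h := by
  obtain ⟨q, hq⟩ := R.exists_forall_mem hC.prop
  have hCq : ∀ v, q ∈ P v → v ∈ C := fun v hv => hC.le_of_ge (R.isClique_setOf_mem q) hq hv
  choose m hm hmP using fun v => exists_gate R.isTree (R.connected v) q
  have hmq : ∀ v : {v : V // v ∉ C ∧ ∃ c ∈ C, G.Adj c v}, m v ≠ q :=
    fun v e => v.2.1 (hCq v (e ▸ hm v))
  choose x hx hxm using fun v => exists_adj_separates R.isTree (hmq v)
  -- A path of `C` reaching `P v` would pass `m v`, hence `m u`, and so meet `P u`.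
  have key : ∀ u v : V, (∃ w' ∈ C, G.Adj w' v ∧ ¬ G.Adj w' u) → u ∉ C →
      ¬ Separates T q (m u) (m v) := by
    rintro u v ⟨w, hw, hwv, hwu⟩ hu huv
    obtain ⟨z, hzw, hzv⟩ := (R.adj_iff w v hwv.ne).1 hwv
    have h1 := Separates.trans huv (hmP v z hzv)
    exact hwu ((R.adj_iff w u (fun e => hu (e ▸ hw))).2
      ⟨m u, h1.mem (R.connected w) (hq w hw) hzw, hm u⟩)
  have hcol : (branchGraph G C).Coloring (T.neighborSet q) := by
    refine Coloring.mk (fun v => ⟨x v, hx v⟩) ?_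
    rintro v w ⟨-, ⟨c, hc, hcv, hcw⟩, hvw, hwv⟩ e
    have e : x v = x w := congrArg Subtype.val e
    have hmem : ∀ {u : V}, G.Adj c u → m u ∈ P c := by
      intro u hcu
      obtain ⟨z, hzc, hzu⟩ := (R.adj_iff c u hcu.ne).1 hcu
      exact (hmP u z hzu).mem (R.connected c) (hq c hc) hzc
    rcases separates_or_separates_of_mem R.isTree (R.connected c) (R.ncard_le c) (hx v) (hq c hc)
      (hmem hcv) (hmem hcw) (hxm v) (e ▸ hxm w) with h | h
    · exact key v w hwv v.2.1 h
    · exact key w v hvw w.2.1 h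
  have := Fintype.ofFinite (T.neighborSet q)
  refine hcol.colorable.mono ?_
  rw [← Nat.card_eq_fintype_card]
  exact hd q

theorem MemClass.colorable_branchGraph [Finite V] {G : SimpleGraph V} {h : ℕ}
    (hG : MemClass h 2 1 G) {C : Set V} (hC : C ∈ cliques G) : (branchGraph G C).Colorable h := by
  obtain ⟨W, _, T, P, hR⟩ := hG
  obtain ⟨R, hd⟩ := isRepresentation_iff.1 hR
  exact R.colorable_branchGraph (fun x => (encard_le_natCast_iff _ _).1 (hd x)) hC

/-! ### Greedy coloring, contraction and reduced representations -/

/-- Adding vertices with at most one neighbour to a colored set. -/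
theorem exists_coloring_of_subsingleton_neighborSet [Finite V] (H : SimpleGraph V) {n : ℕ}
    (hn : 2 ≤ n) (K : Set V) (f : V → Fin n) (hf : ∀ x ∈ K, ∀ y ∈ K, H.Adj x y → f x ≠ f y)
    (hK : ∀ x ∉ K, ∃ y, ∀ z, H.Adj x z → z = y) : Nonempty (H.Coloring (Fin n)) := by
  classical
  have : ∀ F : Set V, F.Finite → (∀ x ∈ F, x ∉ K) →
      ∃ g : V → Fin n, ∀ x ∈ K ∪ F, ∀ y ∈ K ∪ F, H.Adj x y → g x ≠ g y := by
    intro F hF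
    induction F, hF using Set.Finite.induction_on with
    | empty => exact fun _ => ⟨f, by simpa using hf⟩
    | @insert a F ha _ ih =>
      intro haF
      obtain ⟨g, hg⟩ := ih fun x hx => haF x (Or.inr hx)
      obtain ⟨y, hy⟩ := hK a (haF a (Or.inl rfl))
      have : Nontrivial (Fin n) := Fin.nontrivial_iff_two_le.2 hn
      obtain ⟨c, hc⟩ := exists_ne (g y)
      refine ⟨Function.update g a c, ?_⟩
      intro x hx z hz hxz
      by_cases hxa : x = a
      · subst hxa
        obtain rfl := hy z hxz
        rwa [Function.update_self, Function.update_of_ne hxz.ne']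
      · by_cases hza : z = a
        · subst hza
          obtain rfl := hy x hxz.symm
          rw [Function.update_self, Function.update_of_ne hxa]
          exact hc.symm
        · rw [Function.update_of_ne hxa, Function.update_of_ne hza]
          refine hg x ?_ z ?_ hxz
          · rcases hx with h | h | h
            exacts [Or.inl h, absurd h hxa, Or.inr h]
          · rcases hz with h | h | h
            exacts [Or.inl h, absurd h hza, Or.inr h]
  obtain ⟨g, hg⟩ := this Kᶜ (Set.toFinite _) fun x hx => hx
  exact ⟨Coloring.mk g fun {x y} hxy => hg x (by simp) y (by simp) hxy⟩

theorem connected_of_reachable_map {W' : Type*} {H : SimpleGraph W'} (hT : T.Connected)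
    (f : W → W') (hf : ∀ a b, T.Adj a b → H.Reachable (f a) (f b))
    (hs : ∀ y, ∃ x, H.Reachable (f x) y) : H.Connected := by
  have key : ∀ a b, H.Reachable (f a) (f b) := by
    intro a b
    obtain ⟨p⟩ := hT.preconnected a b
    induction p with
    | nil => exact .rfl
    | cons h _ ih => exact (hf _ _ h).trans ih
  have : Nonempty W' := hT.nonempty.map f
  refine ⟨fun y z => ?_⟩
  obtain ⟨a, ha⟩ := hs y
  obtain ⟨b, hb⟩ := hs z
  exact (ha.symm.trans (key a b)).trans hb

/-- Counting edges replaces a direct check of acyclicity after contracting or splitting. -/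
theorem isTree_of_ncard_edgeSet_le [Finite W] (hT : T.Connected)
    (h : T.edgeSet.ncard + 1 ≤ Nat.card W) : T.IsTree :=
  isTree_iff_connected_and_card.2 ⟨hT, le_antisymm h hT.card_vert_le_card_edgeSet_add_one⟩

/-- The image of a graph under a map of the vertices, without the loops. -/
def imageGraph {W' : Type*} (T : SimpleGraph W) (f : W → W') : SimpleGraph W' where
  Adj a b := a ≠ b ∧ ∃ c d, T.Adj c d ∧ f c = a ∧ f d = b
  symm := ⟨fun _ _ ⟨hne, c, d, h, hc, hd⟩ => ⟨hne.symm, d, c, h.symm, hd, hc⟩⟩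
  loopless := ⟨fun _ h => h.1 rfl⟩

theorem imageGraph_reachable {W' : Type*} (f : W → W') {a b : W} (h : T.Adj a b) :
    (imageGraph T f).Reachable (f a) (f b) := by
  by_cases hab : f a = f b
  · rw [hab]
  · exact Adj.reachable ⟨hab, a, b, h, rfl, rfl⟩

/-- The contraction of an edge of a tree is a tree. -/
theorem isTree_imageGraph [Finite W] {W' : Type*} [Finite W'] (hT : T.IsTree) {f : W → W'}
    (hf : f.Surjective) (hcard : Nat.card W ≤ Nat.card W' + 1) {x y : W} (hxy : T.Adj x y)
    (he : f x = f y) : (imageGraph T f).IsTree := by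
  refine isTree_of_ncard_edgeSet_le (connected_of_reachable_map hT.connected f
    (fun a b h => imageGraph_reachable f h)
    fun b => (hf b).imp fun a ha => by rw [ha]) ?_
  have hsub : (imageGraph T f).edgeSet ⊆ Sym2.map f '' (T.edgeSet \ {s(x, y)}) := by
    intro e
    induction e with
    | _ a b =>
      rintro ⟨hne, c, d, hcd, rfl, rfl⟩
      refine ⟨s(c, d), ⟨hcd, ?_⟩, rfl⟩
      intro h
      rcases Sym2.eq_iff.1 h with ⟨rfl, rfl⟩ | ⟨rfl, rfl⟩
      exacts [hne he, hne he.symm]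
  have h1 : (imageGraph T f).edgeSet.ncard ≤ (T.edgeSet \ {s(x, y)}).ncard :=
    (Set.ncard_le_ncard hsub (Set.toFinite _)).trans (Set.ncard_image_le (Set.toFinite _))
  have h2 : (T.edgeSet \ {s(x, y)}).ncard + 1 = T.edgeSet.ncard :=
    Set.ncard_sdiff_singleton_add_one hxy (Set.toFinite _)
  have h3 : T.edgeSet.ncard + 1 = Nat.card W := (isTree_iff_connected_and_card.1 hT).2
  omega

theorem IsPathRepresentation.mem_of_adj_adj {G : SimpleGraph V} {P : V → Set W}
    (R : IsPathRepresentation G T P) {a x b : W} (hax : T.Adj a x) (hxb : T.Adj x b) (hne : a ≠ b)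
    {v : V} (ha : a ∈ P v) (hb : b ∈ P v) : x ∈ P v :=
  (Separates.of_adj_adj R.isTree.isAcyclic hax hxb hne).mem (R.connected v) ha hb

open Classical in
/-- The map contracting `x` into `y`. -/
noncomputable def contractMap {x y : W} (hyx : y ≠ x) (w : W) : {w : W // w ≠ x} :=
  if h : w = x then ⟨y, hyx⟩ else ⟨w, h⟩

theorem contractMap_self {x y : W} (hyx : y ≠ x) : contractMap hyx x = ⟨y, hyx⟩ := by
  simp [contractMap]

theorem contractMap_of_ne {x y w : W} (hyx : y ≠ x) (h : w ≠ x) : contractMap hyx w = ⟨w, h⟩ := by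
  simp [contractMap, h]

/-- If all paths through `x` pass through its neighbor `y`, then `x` can be contracted into `y`. -/
theorem IsPathRepresentation.contract [Finite W] {G : SimpleGraph V} {P : V → Set W}
    (R : IsPathRepresentation G T P) {x y : W} (hxy : T.Adj x y) (hyx : y ≠ x)
    (hP : ∀ v, x ∈ P v → y ∈ P v) :
    IsPathRepresentation G (imageGraph T (contractMap hyx)) fun v => {w | w.1 ∈ P v} := by
  have hmem : ∀ v w, w ∈ P v → (contractMap hyx w).1 ∈ P v := by
    intro v w hw
    by_cases h : w = x
    · subst h
      rw [contractMap_self]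
      exact hP v hw
    · rwa [contractMap_of_ne hyx h]
  have hcard : Nat.card {w : W // w ≠ x} + 1 = Nat.card W := by
    have := Set.ncard_sdiff_singleton_add_one (Set.mem_univ x) (Set.toFinite _)
    rw [Set.ncard_univ] at this
    rw [← this]
    congr 1
    change ({w | w ≠ x} : Set W).ncard = _
    congr 1
    ext w
    simp
  have hadj : ∀ {a b : {w : W // w ≠ x}}, (imageGraph T (contractMap hyx)).Adj a b →
      a ≠ b ∧ (T.Adj a b ∨ (a.1 = y ∧ T.Adj x b) ∨ (b.1 = y ∧ T.Adj a x)) := by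
    rintro a b ⟨hne, c, d, hcd, rfl, rfl⟩
    refine ⟨hne, ?_⟩
    by_cases hc : c = x
    · subst hc
      rw [contractMap_self, contractMap_of_ne hyx hcd.ne']
      exact Or.inr (Or.inl ⟨rfl, hcd⟩)
    · by_cases hd : d = x
      · subst hd
        rw [contractMap_self, contractMap_of_ne hyx hc]
        exact Or.inr (Or.inr ⟨rfl, hcd⟩)
      · rw [contractMap_of_ne hyx hc, contractMap_of_ne hyx hd]
        exact Or.inl hcd
  refine ⟨isTree_imageGraph R.isTree (fun w => ⟨w, contractMap_of_ne hyx w.2⟩) hcard.ge hxy ?_,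
    fun v => ?_, fun v w hw => ?_, fun u v huv => ?_⟩
  · rw [contractMap_self, contractMap_of_ne hyx hyx]
  · refine connected_of_reachable_map (R.connected v)
      (fun w => ⟨contractMap hyx w.1, hmem v w.1 w.2⟩) ?_ ?_
    · intro a b hab
      by_cases h : contractMap hyx a.1 = contractMap hyx b.1
      · simp only [h]
        exact .rfl
      · exact Adj.reachable ⟨h, a, b, hab, rfl, rfl⟩
    · rintro ⟨w, hw⟩
      refine ⟨⟨w, hw⟩, ?_⟩
      simp only [contractMap_of_ne hyx w.2]
      exact .rfl
  · have hw : w.1 ∈ P v := hw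
    rw [← Set.ncard_image_of_injective _ Subtype.val_injective]
    by_cases hwy : w.1 = y
    · have hsub : (Subtype.val '' ((imageGraph T (contractMap hyx)).neighborSet w ∩
          {w : {w : W // w ≠ x} | w.1 ∈ P v})) ⊆
          ((T.neighborSet y ∩ P v) \ {x}) ∪ {b | b ≠ y ∧ T.Adj x b ∧ b ∈ P v} := by
        rintro _ ⟨b, ⟨hb, hbP⟩, rfl⟩
        obtain ⟨hne, h | ⟨-, h⟩ | ⟨h, -⟩⟩ := hadj hb
        · exact Or.inl ⟨⟨hwy ▸ h, hbP⟩, b.2⟩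
        · exact Or.inr ⟨fun e => hne (Subtype.ext (hwy.trans e.symm)), h, hbP⟩
        · exact absurd (Subtype.ext (hwy.trans h.symm)) hne
      -- The merged vertex inherits at most one neighbor from `y` (besides `x`) and at most one from
      -- `x` (besides `y`). If the path misses `x`, it has no vertex beyond `x`.
      by_cases hx : x ∈ P v
      · have h1 := Set.ncard_sdiff_singleton_add_one
          (show x ∈ T.neighborSet y ∩ P v from ⟨hxy.symm, hx⟩) (Set.toFinite _)
        have h2 := Set.ncard_sdiff_singleton_add_one
          (show y ∈ T.neighborSet x ∩ P v from ⟨hxy, hP v hx⟩) (Set.toFinite _)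
        have h3 := R.ncard_le v x hx
        have h4 := R.ncard_le v y (hP v hx)
        have h5 : {b | b ≠ y ∧ T.Adj x b ∧ b ∈ P v} = (T.neighborSet x ∩ P v) \ {y} := by
          ext b
          simp [and_comm]
        rw [h5] at hsub
        have h6 := (Set.ncard_le_ncard hsub (Set.toFinite _)).trans (Set.ncard_union_le _ _)
        omega
      · refine (Set.ncard_le_ncard ?_ (Set.toFinite _)).trans (R.ncard_le v y (hwy ▸ hw))
        refine hsub.trans (Set.union_subset Set.sdiff_subset ?_)
        rintro b ⟨hby, hxb, hb⟩
        exact absurd (R.mem_of_adj_adj hxy.symm hxb (Ne.symm hby) (hwy ▸ hw) hb) hx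
    · classical
      have hsub : (Subtype.val '' ((imageGraph T (contractMap hyx)).neighborSet w ∩
          {w : {w : W // w ≠ x} | w.1 ∈ P v})) ⊆
          (fun b => if b = x then y else b) '' (T.neighborSet w ∩ P v) := by
        rintro _ ⟨b, ⟨hb, hbP⟩, rfl⟩
        obtain ⟨hne, h | ⟨h, -⟩ | ⟨h, h'⟩⟩ := hadj hb
        · exact ⟨b, ⟨h, hbP⟩, if_neg b.2⟩
        · exact absurd h hwy
        · refine ⟨x, ⟨h', R.mem_of_adj_adj h' hxy hwy hw (h ▸ hbP)⟩, ?_⟩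
          simp [h]
      exact ((Set.ncard_le_ncard hsub (Set.toFinite _)).trans
        (Set.ncard_image_le (Set.toFinite _))).trans (R.ncard_le v w hw)
  · rw [R.adj_iff u v huv]
    constructor
    · rintro ⟨w, hu, hv⟩
      exact ⟨contractMap hyx w, hmem u w hu, hmem v w hv⟩
    · rintro ⟨w, hu, hv⟩
      exact ⟨w, hu, hv⟩

/-- Each contraction removes a tree vertex, so the process stops. -/
theorem IsVPT.exists_reduced {G : SimpleGraph V} (hG : IsVPT G) :
    ∃ (W : Type) (_ : Finite W) (T : SimpleGraph W) (P : V → Set W), IsPathRepresentation G T P ∧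
      ∀ x y, T.Adj x y → ∃ v, x ∈ P v ∧ y ∉ P v := by
  obtain ⟨W, hW, T, P, hR⟩ := hG
  have R := (isRepresentation_iff.1 hR).1
  clear hR
  induction hn : Nat.card W using Nat.strong_induction_on generalizing W with
  | _ n ih =>
    subst hn
    by_cases h : ∀ x y, T.Adj x y → ∃ v, x ∈ P v ∧ y ∉ P v
    · exact ⟨W, hW, T, P, R, h⟩
    · push Not at h
      obtain ⟨x, y, hxy, hP⟩ := h
      exact ih _ (Finite.card_subtype_lt (p := (· ≠ x)) (x := x) (by simp)) _ inferInstance _ _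
        (R.contract hxy hxy.ne' hP) rfl

/-! ### From branch graph colorings to local colorings of the tree -/

/-- The neighbors of `q` can be colored with `n` colors such that two of them joined by a path
through `q` have distinct colors. -/
def IsLocallyColorable (T : SimpleGraph W) (P : V → Set W) (n : ℕ) (q : W) : Prop :=
  ∃ f : W → Fin n, ∀ x y, T.Adj q x → T.Adj q y → x ≠ y →
    (∃ v, q ∈ P v ∧ x ∈ P v ∧ y ∈ P v) → f x ≠ f y

section Reduced

variable {G : SimpleGraph V} {P : V → Set W}

/-- A larger clique has a common vertex `r`. If `r ≠ q`, all paths through `q` would use the first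
edge towards `r`, which reducedness forbids. -/
theorem IsPathRepresentation.setOf_mem_mem_cliques [Finite V] [Finite W]
    (R : IsPathRepresentation G T P) (hP : ∀ x y, T.Adj x y → ∃ v, x ∈ P v ∧ y ∉ P v) (q : W) :
    {v | q ∈ P v} ∈ cliques G := by
  refine ⟨R.isClique_setOf_mem q, fun D hD hqD => ?_⟩
  obtain ⟨r, hr⟩ := R.exists_forall_mem hD
  by_cases hrq : r = q
  · subst hrq
    exact hr
  · obtain ⟨x, hqx, hx⟩ := exists_adj_separates R.isTree hrq
    obtain ⟨v, hv, hxv⟩ := hP q x hqx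
    exact absurd (hx.mem (R.connected v) hv (hr v (hqD hv))) hxv

/-- The two paths lie in different components of `T - q`. -/
theorem IsPathRepresentation.disjoint_of_adj (R : IsPathRepresentation G T P) {q x y : W}
    (hqx : T.Adj q x) (hqy : T.Adj q y) (hxy : x ≠ y) {u v : V} (hxu : x ∈ P u) (hqu : q ∉ P u)
    (hyv : y ∈ P v) (hqv : q ∉ P v) : ¬ (P u ∩ P v).Nonempty := by
  rintro ⟨z, hzu, hzv⟩
  have hx := separates_of_adj_of_notMem R.isTree.isAcyclic (R.connected u) hqx hqu hxu hzu
  have hy := separates_of_adj_of_notMem R.isTree.isAcyclic (R.connected v) hqy hqv hyv hzv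
  rcases hx.total R.isTree.connected hy with h | h
  · exact hxy (h.eq_of_adj hqy hqx.ne')
  · exact hxy (h.eq_of_adj hqx hqy.ne').symm

theorem IsPathRepresentation.isLocallyColorable [Finite V] [Nonempty V] [Finite W]
    (R : IsPathRepresentation G T P) (hP : ∀ x y, T.Adj x y → ∃ v, x ∈ P v ∧ y ∉ P v) {n : ℕ}
    (hn : 2 ≤ n) (hcol : ∀ C ∈ cliques G, (branchGraph G C).Colorable n) (q : W) :
    IsLocallyColorable T P n q := by
  classical
  obtain ⟨col⟩ := hcol _ (R.setOf_mem_mem_cliques hP q)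
  -- A path through `x` avoiding `q` represents the neighbor `x` in the branch graph.
  choose! g hg using fun x (h : T.Adj q x) => hP x q h.symm
  let H : SimpleGraph W :=
    { Adj := fun x y => x ≠ y ∧ T.Adj q x ∧ T.Adj q y ∧ ∃ v, q ∈ P v ∧ x ∈ P v ∧ y ∈ P v
      symm := ⟨fun _ _ ⟨h, hx, hy, v, hq, hvx, hvy⟩ => ⟨h.symm, hy, hx, v, hq, hvy, hvx⟩⟩
      loopless := ⟨fun _ h => h.1 rfl⟩ }
  -- On `K` condition (3) of the branch graph holds, so `g` carries `H`-edges within `K` to branch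
  -- graph edges.
  let K : Set W := {x | T.Adj q x ∧ (∃ v, q ∈ P v ∧ x ∈ P v) ∧
    ∀ y, T.Adj q y → y ≠ x → ∃ v, q ∈ P v ∧ x ∈ P v ∧ y ∉ P v}
  let B : Set V := {v | v ∉ {v | q ∈ P v} ∧ ∃ c ∈ {v | q ∈ P v}, G.Adj c v}
  -- The default color is irrelevant on `K`, by `hB`.
  let f : W → Fin n := fun x => if h : g x ∈ B then col ⟨g x, h⟩ else ⟨0, by omega⟩
  have hadj : ∀ x, T.Adj q x → ∀ v, q ∈ P v → x ∈ P v → G.Adj v (g x) := fun x hx v hq hv =>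
    (R.adj_iff v (g x) fun e => (hg x hx).2 (e ▸ hq)).2 ⟨x, hv, (hg x hx).1⟩
  have hmem : ∀ x, T.Adj q x → ∀ v, q ∈ P v → G.Adj v (g x) → x ∈ P v := by
    intro x hx v hq hv
    obtain ⟨z, hzv, hz⟩ := (R.adj_iff v (g x) hv.ne).1 hv
    exact (separates_of_adj_of_notMem R.isTree.isAcyclic (R.connected (g x)) hx (hg x hx).2
      (hg x hx).1 hz).mem (R.connected v) hq hzv
  have hB : ∀ x ∈ K, g x ∈ B := by
    rintro x ⟨hx, ⟨v, hq, hv⟩, -⟩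
    exact ⟨(hg x hx).2, v, hq, hadj x hx v hq hv⟩
  suffices hF : Nonempty (H.Coloring (Fin n)) by
    obtain ⟨F⟩ := hF
    exact ⟨F, fun x y hx hy hxy hv => F.valid (v := x) (w := y) ⟨hxy, hx, hy, hv⟩⟩
  refine exists_coloring_of_subsingleton_neighborSet H hn K f ?_ ?_
  · rintro x hxK y hyK ⟨hxy, hx, hy, v, hq, hvx, hvy⟩
    simp only [f, dif_pos (hB x hxK), dif_pos (hB y hyK)]
    refine col.valid ⟨fun h => ?_, ⟨v, hq, hadj x hx v hq hvx, hadj y hy v hq hvy⟩, ?_, ?_⟩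
    · exact R.disjoint_of_adj hx hy hxy (hg x hx).1 (hg x hx).2 (hg y hy).1 (hg y hy).2
        ((R.adj_iff _ _ h.ne).1 h)
    · obtain ⟨w, hqw, hxw, hyw⟩ := hxK.2.2 y hy hxy.symm
      exact ⟨w, hqw, hadj x hx w hqw hxw, fun h => hyw (hmem y hy w hqw h)⟩
    · obtain ⟨w, hqw, hyw, hxw⟩ := hyK.2.2 x hx hxy
      exact ⟨w, hqw, hadj y hy w hqw hyw, fun h => hxw (hmem x hx w hqw h)⟩
  · intro x hxK
    by_cases hz : ∃ z, H.Adj x z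
    · obtain ⟨z₀, -, hx, -, v₀, hq₀, hx₀, -⟩ := hz
      -- All paths through `q` and `x` leave `q` on its other side by the same `y`, the only
      -- `H`-neighbor of `x`.
      have : ∃ y, T.Adj q y ∧ y ≠ x ∧ ∀ v, q ∈ P v → x ∈ P v → y ∈ P v := by
        by_contra! h
        exact hxK ⟨hx, ⟨v₀, hq₀, hx₀⟩, h⟩
      obtain ⟨y, hy, hyx, hyP⟩ := this
      refine ⟨y, ?_⟩
      rintro z ⟨hxz, -, hz, v, hq, hvx, hvz⟩
      rcases ncard_le_two_cases (Set.toFinite _) (R.ncard_le v q hq) ⟨hx, hvx⟩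
        ⟨hy, hyP v hq hvx⟩ ⟨hz, hvz⟩ with h | h | h
      exacts [absurd h.symm hyx, absurd h hxz, h.symm]
    · push Not at hz
      exact ⟨x, fun z h => absurd h (hz z)⟩

end Reduced

/-! ### Splitting a vertex of large degree -/

theorem ncard_pair_le (a b : W) : ({a, b} : Set W).ncard ≤ 2 :=
  (Set.ncard_insert_le _ _).trans (by simp)

/-- The graph obtained by detaching `a` and `b` from `q` and joining `q`, `a` and `b` to a new
vertex. -/
def splitGraph (T : SimpleGraph W) (q a b : W) : SimpleGraph (Option W) where
  Adj
    | some u, some v => T.Adj u v ∧ s(u, v) ≠ s(q, a) ∧ s(u, v) ≠ s(q, b)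
    | some u, none => u = q ∨ u = a ∨ u = b
    | none, some u => u = q ∨ u = a ∨ u = b
    | none, none => False
  symm := ⟨by
    rintro (_ | u) (_ | v) h
    · exact h
    · exact h
    · exact h
    · exact ⟨h.1.symm, Sym2.eq_swap (a := u) (b := v) ▸ h.2.1,
        Sym2.eq_swap (a := u) (b := v) ▸ h.2.2⟩⟩
  loopless := ⟨by
    rintro (_ | u) h
    · exact h
    · exact h.1.ne rfl⟩

/-- The paths in `splitGraph` that correspond to the paths in the original tree. -/
def splitPath (q a b : W) (S : Set W) : Set (Option W)
  | some w => w ∈ S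
  | none => q ∈ S ∧ (a ∈ S ∨ b ∈ S)

section Split

variable {q a b : W}

@[simp] theorem splitGraph_adj_some_none {u : W} :
    (splitGraph T q a b).Adj (some u) none ↔ u = q ∨ u = a ∨ u = b := Iff.rfl

@[simp] theorem splitGraph_adj_none_some {u : W} :
    (splitGraph T q a b).Adj none (some u) ↔ u = q ∨ u = a ∨ u = b := Iff.rfl

@[simp] theorem some_mem_splitPath {S : Set W} {w : W} : some w ∈ splitPath q a b S ↔ w ∈ S :=
  Iff.rfl

@[simp] theorem none_mem_splitPath {S : Set W} :
    none ∈ splitPath q a b S ↔ q ∈ S ∧ (a ∈ S ∨ b ∈ S) := Iff.rfl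

/-- Connectivity survives, and one new vertex comes with three new edges for two deleted ones. -/
theorem isTree_splitGraph [Finite W] (hT : T.IsTree) (ha : T.Adj q a) (hb : T.Adj q b)
    (hab : a ≠ b) : (splitGraph T q a b).IsTree := by
  have hqn : (splitGraph T q a b).Adj (some q) none := by simp
  have han : (splitGraph T q a b).Adj (some a) none := by simp
  have hbn : (splitGraph T q a b).Adj (some b) none := by simp
  refine isTree_of_ncard_edgeSet_le (connected_of_reachable_map hT.connected some ?_ ?_) ?_
  · intro u v huv
    by_cases h1 : s(u, v) = s(q, a)
    · rcases Sym2.eq_iff.1 h1 with ⟨rfl, rfl⟩ | ⟨rfl, rfl⟩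
      exacts [hqn.reachable.trans han.reachable.symm, han.reachable.trans hqn.reachable.symm]
    · by_cases h2 : s(u, v) = s(q, b)
      · rcases Sym2.eq_iff.1 h2 with ⟨rfl, rfl⟩ | ⟨rfl, rfl⟩
        exacts [hqn.reachable.trans hbn.reachable.symm, hbn.reachable.trans hqn.reachable.symm]
      · exact Adj.reachable ⟨huv, h1, h2⟩
  · rintro (_ | w)
    exacts [⟨q, hqn.reachable⟩, ⟨w, .rfl⟩]
  · have hsub : (splitGraph T q a b).edgeSet ⊆
        Sym2.map some '' ((T.edgeSet \ {s(q, a)}) \ {s(q, b)}) ∪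
          {s(some q, none), s(some a, none), s(some b, none)} := by
      intro e
      induction e with
      | _ u v =>
        rcases u with _ | u <;> rcases v with _ | v
        · exact fun h => h.elim
        · rintro (rfl | rfl | rfl) <;> simp
        · rintro (rfl | rfl | rfl) <;> simp
        · rintro ⟨h, h1, h2⟩
          exact Or.inl ⟨s(u, v), ⟨⟨h, h1⟩, h2⟩, rfl⟩
    have h1 := (Set.ncard_le_ncard hsub (Set.toFinite _)).trans (Set.ncard_union_le _ _)
    have h2 := Set.ncard_image_le (f := Sym2.map (some : W → Option W))
      (Set.toFinite ((T.edgeSet \ {s(q, a)}) \ {s(q, b)}))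
    have h3 : ({s(some q, none), s(some a, none), s(some b, none)} :
        Set (Sym2 (Option W))).ncard ≤ 3 :=
      (Set.ncard_insert_le _ _).trans (Nat.succ_le_succ (ncard_pair_le _ _))
    have h4 : ((T.edgeSet \ {s(q, a)}) \ {s(q, b)}).ncard + 1 = (T.edgeSet \ {s(q, a)}).ncard := by
      refine Set.ncard_sdiff_singleton_add_one ⟨hb, fun h => ?_⟩ (Set.toFinite _)
      exact hab (Sym2.congr_right.1 h).symm
    have h5 : (T.edgeSet \ {s(q, a)}).ncard + 1 = T.edgeSet.ncard :=
      Set.ncard_sdiff_singleton_add_one ha (Set.toFinite _)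
    have h6 : T.edgeSet.ncard + 1 = Nat.card W := (isTree_iff_connected_and_card.1 hT).2
    have h7 : Nat.card (Option W) = Nat.card W + 1 := Finite.card_option
    omega

theorem neighborSet_splitGraph_none :
    (splitGraph T q a b).neighborSet none = {some q, some a, some b} := by
  ext (_ | w) <;> simp [mem_neighborSet]

open Classical in
/-- The neighbor of `some w` in the split graph that corresponds to the neighbor `u` of `w`. -/
noncomputable def splitNeighbor (q a b w u : W) : Option W :=
  if s(w, u) = s(q, a) ∨ s(w, u) = s(q, b) then none else some u

/-- Bounds degrees of old vertices along a path and, with `S = Set.univ`, in the whole tree. -/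
theorem neighborSet_splitGraph_some_subset (ha : T.Adj q a) (hb : T.Adj q b) (S : Set W)
    (w : W) :
    (splitGraph T q a b).neighborSet (some w) ∩ splitPath q a b S ⊆
      splitNeighbor q a b w '' (T.neighborSet w ∩ S) := by
  rintro (_ | u) ⟨h, hu⟩
  · obtain ⟨hq, hu⟩ := hu
    rcases h with rfl | rfl | rfl
    · rcases hu with hu | hu
      · exact ⟨a, ⟨ha, hu⟩, by simp [splitNeighbor]⟩
      · exact ⟨b, ⟨hb, hu⟩, by simp [splitNeighbor]⟩
    · exact ⟨q, ⟨ha.symm, hq⟩, by simp [splitNeighbor]⟩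
    · exact ⟨q, ⟨hb.symm, hq⟩, by simp [splitNeighbor]⟩
  · obtain ⟨h, h1, h2⟩ := h
    exact ⟨u, ⟨h, hu⟩, by simp only [splitNeighbor, h1, h2, or_self, if_false]⟩

theorem IsPathRepresentation.split [Finite W] {G : SimpleGraph V} {P : V → Set W}
    (R : IsPathRepresentation G T P) (ha : T.Adj q a) (hb : T.Adj q b) (hab : a ≠ b)
    (hP : ∀ v, q ∈ P v → a ∈ P v → b ∉ P v) :
    IsPathRepresentation G (splitGraph T q a b) fun v => splitPath q a b (P v) := by
  refine ⟨isTree_splitGraph R.isTree ha hb hab, fun v => ?_, fun v w hw => ?_, fun u v huv => ?_⟩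
  · have hadj : ∀ u, (u = q ∨ u = a ∨ u = b) → (hu : u ∈ P v) →
        (hn : none ∈ splitPath q a b (P v)) →
        ((splitGraph T q a b).induce (splitPath q a b (P v))).Reachable ⟨some u, hu⟩ ⟨none, hn⟩ :=
      fun u h hu hn => Adj.reachable (show (splitGraph T q a b).Adj (some u) none from h)
    refine connected_of_reachable_map (R.connected v) (fun w => ⟨some w.1, w.2⟩) ?_ ?_
    · rintro ⟨u, hu⟩ ⟨w, hw⟩ h
      have h : T.Adj u w := h
      by_cases h1 : s(u, w) = s(q, a)
      · rcases Sym2.eq_iff.1 h1 with ⟨rfl, rfl⟩ | ⟨rfl, rfl⟩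
        · exact (hadj _ (by simp) hu ⟨hu, Or.inl hw⟩).trans (hadj _ (by simp) hw _).symm
        · exact (hadj _ (by simp) hu ⟨hw, Or.inl hu⟩).trans (hadj _ (by simp) hw _).symm
      · by_cases h2 : s(u, w) = s(q, b)
        · rcases Sym2.eq_iff.1 h2 with ⟨rfl, rfl⟩ | ⟨rfl, rfl⟩
          · exact (hadj _ (by simp) hu ⟨hu, Or.inr hw⟩).trans (hadj _ (by simp) hw _).symm
          · exact (hadj _ (by simp) hu ⟨hw, Or.inr hu⟩).trans (hadj _ (by simp) hw _).symm
        · exact Adj.reachable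
            (show (splitGraph T q a b).Adj (some u) (some w) from ⟨h, h1, h2⟩)
    · rintro ⟨_ | w, hw⟩
      · exact ⟨⟨q, hw.1⟩, hadj q (Or.inl rfl) hw.1 hw⟩
      · exact ⟨⟨w, hw⟩, .rfl⟩
  · classical
    rcases w with _ | w
    · have hsub : (splitGraph T q a b).neighborSet none ∩ splitPath q a b (P v) ⊆
          {some q, if a ∈ P v then some a else some b} := by
        rw [neighborSet_splitGraph_none]
        rintro x ⟨rfl | rfl | rfl, hx⟩
        · simp
        · simp [if_pos (show a ∈ P v from hx)]
        · have : a ∉ P v := fun h => hP v hw.1 h hx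
          simp [this]
      exact (Set.ncard_le_ncard hsub (Set.toFinite _)).trans (ncard_pair_le _ _)
    · exact ((Set.ncard_le_ncard (neighborSet_splitGraph_some_subset ha hb (P v) w)
        (Set.toFinite _)).trans (Set.ncard_image_le (Set.toFinite _))).trans (R.ncard_le v w hw)
  · rw [R.adj_iff u v huv]
    constructor
    · rintro ⟨w, hu, hv⟩
      exact ⟨some w, hu, hv⟩
    · rintro ⟨_ | w, hu, hv⟩
      exacts [⟨q, hu.1, hv.1⟩, ⟨w, hu, hv⟩]

theorem ncard_neighborSet_splitGraph_none_le :
    ((splitGraph T q a b).neighborSet none).ncard ≤ 3 := by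
  rw [neighborSet_splitGraph_none]
  exact (Set.ncard_insert_le _ _).trans (Nat.succ_le_succ (ncard_pair_le _ _))

theorem ncard_neighborSet_splitGraph_some_le [Finite W] (ha : T.Adj q a) (hb : T.Adj q b) (w : W) :
    ((splitGraph T q a b).neighborSet (some w)).ncard ≤ (T.neighborSet w).ncard := by
  have h := neighborSet_splitGraph_some_subset ha hb Set.univ w
  have hu : splitPath q a b (Set.univ : Set W) = Set.univ := by
    ext (_ | w) <;> simp
  rw [hu, Set.inter_univ, Set.inter_univ] at h
  exact (Set.ncard_le_ncard h (Set.toFinite _)).trans (Set.ncard_image_le (Set.toFinite _))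

theorem ncard_neighborSet_splitGraph_center_lt [Finite W] (ha : T.Adj q a) (hb : T.Adj q b)
    (hab : a ≠ b) :
    ((splitGraph T q a b).neighborSet (some q)).ncard < (T.neighborSet q).ncard := by
  -- Both `a` and `b` become `none`, so `b` can be dropped from the count.
  have hsub : (splitGraph T q a b).neighborSet (some q) ⊆
      splitNeighbor q a b q '' (T.neighborSet q \ {b}) := by
    rintro (_ | u) h
    · exact ⟨a, ⟨ha, hab⟩, by simp [splitNeighbor]⟩
    · obtain ⟨h, h1, h2⟩ := h
      refine ⟨u, ⟨h, ?_⟩, by simp only [splitNeighbor, h1, h2, or_self, if_false]⟩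
      rintro rfl
      exact h2 rfl
  have h1 := (Set.ncard_le_ncard hsub (Set.toFinite _)).trans (Set.ncard_image_le (Set.toFinite _))
  have h2 := Set.ncard_sdiff_singleton_add_one (show b ∈ T.neighborSet q from hb) (Set.toFinite _)
  omega

/-- The three neighbors get three distinct colors, which needs `3 ≤ n`. -/
theorem isLocallyColorable_splitGraph_none {n : ℕ} (hn : 3 ≤ n) (P : V → Set (Option W))
    (ha : T.Adj q a) (hb : T.Adj q b) (hab : a ≠ b) :
    IsLocallyColorable (splitGraph T q a b) P n none := by
  classical
  refine ⟨fun x => if x = some q then ⟨0, by omega⟩ else if x = some a then ⟨1, by omega⟩ else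
    ⟨2, by omega⟩, ?_⟩
  rintro (_ | x) (_ | y) hx hy hxy -
  · exact absurd rfl hxy
  · exact hx.elim
  · exact hy.elim
  · have := ha.ne'
    have := hb.ne'
    rcases hx with rfl | rfl | rfl <;> rcases hy with rfl | rfl | rfl <;>
      simp_all [Ne.symm]

theorem isLocallyColorable_splitGraph_some {n : ℕ} {P : V → Set W} (ha : T.Adj q a)
    (hb : T.Adj q b) {f : W → Fin n} (hf : ∀ x y, T.Adj q x → T.Adj q y → x ≠ y →
      (∃ v, q ∈ P v ∧ x ∈ P v ∧ y ∈ P v) → f x ≠ f y) (hfab : f a = f b) (w : W)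
    (hw : IsLocallyColorable T P n w) :
    IsLocallyColorable (splitGraph T q a b) (fun v => splitPath q a b (P v)) n (some w) := by
  -- Here `c` colors the new vertex: the common color of `a` and `b` when seen from `q`, the color
  -- of `q` when seen from `a` or `b`.
  suffices h : ∃ (f : W → Fin n) (c : Fin n),
      (∀ x y, T.Adj w x → T.Adj w y → x ≠ y → (∃ v, w ∈ P v ∧ x ∈ P v ∧ y ∈ P v) → f x ≠ f y) ∧
      ((w = q ∨ w = a ∨ w = b) → ∀ x, (splitGraph T q a b).Adj (some w) (some x) → ∀ v, w ∈ P v →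
        x ∈ P v → none ∈ splitPath q a b (P v) → f x ≠ c) by
    obtain ⟨f, c, hf, hc⟩ := h
    refine ⟨fun x => x.elim c f, ?_⟩
    rintro (_ | x) (_ | y) hx hy hxy ⟨v, hwv, hxv, hyv⟩
    · exact absurd rfl hxy
    · exact (hc hx y hy v hwv hyv hxv).symm
    · exact hc hy x hx v hwv hxv hyv
    · exact hf x y hx.1 hy.1 (fun e => hxy (congrArg some e)) ⟨v, hwv, hxv, hyv⟩
  by_cases hwq : w = q
  · subst hwq
    refine ⟨f, f a, hf, ?_⟩
    rintro - x ⟨hx, hxa, hxb⟩ v hwv hxv ⟨-, h | h⟩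
    · exact hf x a hx ha (fun e => hxa (e ▸ rfl)) ⟨v, hwv, hxv, h⟩
    · exact hfab ▸ hf x b hx hb (fun e => hxb (e ▸ rfl)) ⟨v, hwv, hxv, h⟩
  · obtain ⟨g, hg⟩ := hw
    refine ⟨g, g q, hg, ?_⟩
    rintro (rfl | rfl | rfl) x ⟨hx, hxa, hxb⟩ v hwv hxv ⟨hqv, -⟩
    · exact absurd rfl hwq
    · exact hg x q hx ha.symm (fun e => hxa (e ▸ Sym2.eq_swap)) ⟨v, hwv, hxv, hqv⟩
    · exact hg x q hx hb.symm (fun e => hxb (e ▸ Sym2.eq_swap)) ⟨v, hwv, hxv, hqv⟩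

end Split

/-! ### Bounding the degree and conclusion -/

theorem memClass_of_isLocallyColorable {n : ℕ} (hn : 3 ≤ n) {G : SimpleGraph V} {W : Type}
    [Fintype W] {T : SimpleGraph W} {P : V → Set W} (R : IsPathRepresentation G T P)
    (hP : ∀ q, IsLocallyColorable T P n q) : MemClass n 2 1 G := by
  -- Splitting lowers the total excess degree; the new vertex, of degree at most `3 ≤ n`, adds none.
  induction hk : ∑ w, ((T.neighborSet w).ncard - n) using Nat.strong_induction_on
    generalizing W with
  | _ k ih =>
    subst hk
    by_cases h : ∀ w, (T.neighborSet w).ncard ≤ n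
    · exact ⟨W, inferInstance, T, P,
        isRepresentation_iff.2 ⟨R, fun x => (encard_le_natCast_iff _ _).2 (h x)⟩⟩
    · push Not at h
      obtain ⟨q, hq⟩ := h
      obtain ⟨f, hf⟩ := hP q
      obtain ⟨a, ha, b, hb, hab, hfab⟩ := Set.exists_ne_map_eq_of_ncard_lt_of_maps_to
        (s := T.neighborSet q) (t := (Set.univ : Set (Fin n))) (f := f)
        (by rwa [Set.ncard_univ, Nat.card_fin]) (fun x _ => Set.mem_univ _)
      have hPab : ∀ v, q ∈ P v → a ∈ P v → b ∉ P v :=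
        fun v hqv hav hbv => hf a b ha hb hab ⟨v, hqv, hav, hbv⟩ hfab
      refine ih _ ?_ (R.split ha hb hab hPab) ?_ rfl
      · rw [Fintype.sum_option]
        have h0 : ((splitGraph T q a b).neighborSet none).ncard - n = 0 := by
          have := ncard_neighborSet_splitGraph_none_le (T := T) (q := q) (a := a) (b := b)
          omega
        rw [h0, zero_add]
        refine Finset.sum_lt_sum (fun w _ => ?_) ⟨q, Finset.mem_univ q, ?_⟩
        · exact Nat.sub_le_sub_right (ncard_neighborSet_splitGraph_some_le ha hb w) n
        · have := ncard_neighborSet_splitGraph_center_lt ha hb hab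
          omega
      · rintro (_ | w)
        · exact isLocallyColorable_splitGraph_none hn _ ha hb hab
        · exact isLocallyColorable_splitGraph_some ha hb hf hfab w (hP w)

theorem IsVPT.memClass_of_colorable [Finite V] [Nonempty V] {G : SimpleGraph V} (hG : IsVPT G)
    {n : ℕ} (hn : 3 ≤ n) (hcol : ∀ C ∈ cliques G, (branchGraph G C).Colorable n) :
    MemClass n 2 1 G := by
  obtain ⟨W, _, T, P, R, hP⟩ := hG.exists_reduced
  have := Fintype.ofFinite W
  exact memClass_of_isLocallyColorable hn R fun q =>
    R.isLocallyColorable hP (by omega) hcol q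

theorem IsVPT.memClass_and_not_memClass [Finite V] [Nonempty V] {G : SimpleGraph V} (hG : IsVPT G)
    {n : ℕ} (hn : 3 ≤ n) (h : MaxBranchChromaticEq G n) :
    MemClass n 2 1 G ∧ ¬ MemClass ((n - 1 : ℕ) : ℕ∞) 2 1 G := by
  obtain ⟨⟨C, hC, hCn⟩, hmax⟩ := h
  refine ⟨hG.memClass_of_colorable hn fun D hD =>
    chromaticNumber_le_iff_colorable.1 (hmax ⟨D, hD, rfl⟩), fun hmem => ?_⟩
  have := (hmem.colorable_branchGraph hC).chromaticNumber_le
  rw [hCn, Nat.cast_le] at this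
  omega

end SubtreeGraph

theorem theorem3p5 {V : Type*} [Finite V] (G : SimpleGraph V) (hconn : G.Connected)
    (hG : SubtreeGraph.IsVPT G) :
    (∀ h : ℕ, 4 ≤ h →
      ((SubtreeGraph.MemClass (h : ℕ∞) 2 1 G ∧ ¬ SubtreeGraph.MemClass ((h - 1 : ℕ) : ℕ∞) 2 1 G) ↔
        SubtreeGraph.MaxBranchChromaticEq G h)) ∧
    (SubtreeGraph.MaxBranchChromaticEq G 3 →
      (SubtreeGraph.MemClass 3 2 1 G ∧ ¬ SubtreeGraph.MemClass 2 2 1 G)) := by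
  have := hconn.nonempty
  refine ⟨fun h hh => ⟨fun ⟨hmem, hnot⟩ => ?_, hG.memClass_and_not_memClass (by omega)⟩,
    hG.memClass_and_not_memClass le_rfl⟩
  have hle : ∀ C ∈ SubtreeGraph.cliques G,
      (SubtreeGraph.branchGraph G C).chromaticNumber ≤ h :=
    fun C hC => (hmem.colorable_branchGraph hC).chromaticNumber_le
  have hex : ∃ C ∈ SubtreeGraph.cliques G, ¬ (SubtreeGraph.branchGraph G C).Colorable (h - 1) := by
    by_contra! hcol
    -- This needs `3 ≤ h - 1`, which is why the forward implication asks for `h ≥ 4`.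
    exact hnot (hG.memClass_of_colorable (by omega) hcol)
  obtain ⟨C, hC, hCh⟩ := hex
  refine ⟨⟨C, hC, le_antisymm (hle C hC) ?_⟩, ?_⟩
  · rw [SimpleGraph.le_chromaticNumber_iff_colorable]
    intro m hm
    by_contra hlt
    exact hCh (hm.mono (by omega))
  · rintro _ ⟨D, hD, rfl⟩
    exact hle D hD
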